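/- A camera sends video frames $0,1,2,\dots$ to an edge server. Frame $0$ is generated at time $0$, and each further frame is generated at the instant at which the transmission of the previous frame finishes; frame $i$ has transmission time $T_i$, computation time $O_i$, and an indicator $B_i$ of whether its recognition is accurate. The server uses the last-come-first-serve-with-preemption (LCFSP) policy: an arriving frame is processed at once and preempts (and thereby discards) the frame that is being processed, if any; so frame $i$ yields a result, at the instant $T_0+\dots+T_i+O_i$, if and only if $O_i<T_{i+1}$. Assume that all the random variables $T_i,O_i,B_i$ are mutually independent, that $T_i$ and $O_i$ are exponentially distributed with means $1/\lambda$ and $1/\mu$ ($\lambda,\mu>0$), and that $B_i$ is Bernoulli with $\mathbb{P}(B_i=1)=p\in(0,1]$. The age of processed information (AoPI) $\Delta(t)$ is the time elapsed at $t$ since the generation of the latest accurately recognized frame whose result has been received by time $t$ (a result of some age $a_0\ge 0$ being held at time $0$). Then the long-run average AoPI exists almost surely and is $$A_{\mathrm L}=\lim_{t\to\infty}\frac1t\int_0^t\Delta(s)\,ds=\Bigl(1+\frac1p\Bigr)\frac1\lambda+\frac1{p\mu}.$$ -/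

import Mathlib

open MeasureTheory ProbabilityTheory Filter Topology

noncomputable section

namespace LCFSP

/-! Sample-path description of one camera and its edge server.  Frames are numbered `0, 1, 2, …`;
`T i` and `O i` are the transmission and the computation time of frame `i`, and `B i` tells whether
its recognition is accurate. -/

/-- The instant at which frame `i` is generated.  Frame `0` is generated at time `0`, and each later
frame is generated at the instant at which the transmission of its predecessor finishes. -/
def genTime (T : ℕ → ℝ) (i : ℕ) : ℝ := ∑ k ∈ Finset.range i, T k

/-- The instant at which frame `i` arrives at the edge server. -/
def arrivalTime (T : ℕ → ℝ) (i : ℕ) : ℝ := genTime T i + T i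

/-- The instant at which the computation of frame `i` finishes, provided that it is not preempted:
an arriving frame is served at once, since it preempts any frame that is being processed. -/
def completionTime (T O : ℕ → ℝ) (i : ℕ) : ℝ := arrivalTime T i + O i

/-- Frame `i` is not preempted: its computation finishes before the next frame arrives.
A preempted frame is discarded. -/
def NotPreempted (T O : ℕ → ℝ) (i : ℕ) : Prop := completionTime T O i < arrivalTime T (i + 1)

/-- By time `t` the user has received an accurate recognition result of frame `i`. -/
def AccuratelyReceived (T O : ℕ → ℝ) (B : ℕ → Bool) (t : ℝ) (i : ℕ) : Prop :=
  NotPreempted T O i ∧ B i = true ∧ completionTime T O i ≤ t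

/-- The generation time of the latest accurately recognized frame that the user has received by
time `t`.  At time `0` the user holds a result of age `a₀`, that is, one generated at `-a₀`. -/
def latestGenTime (a₀ : ℝ) (T O : ℕ → ℝ) (B : ℕ → Bool) (t : ℝ) : ℝ :=
  sSup (insert (-a₀) (genTime T '' {i | AccuratelyReceived T O B t i}))

/-- The age of processed information at time `t` under last-come-first-serve with preemption: the
time elapsed since the generation of the latest accurately recognized frame received by the user. -/
def AoPI (a₀ : ℝ) (T O : ℕ → ℝ) (B : ℕ → Bool) (t : ℝ) : ℝ :=
  t - latestGenTime a₀ T O B t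

/-- The average of the age of processed information over the time interval `[0, t]`. -/
def averageAoPI (a₀ : ℝ) (T O : ℕ → ℝ) (B : ℕ → Bool) (t : ℝ) : ℝ :=
  (∫ s in (0 : ℝ)..t, AoPI a₀ T O B s) / t

end LCFSP

end

/-! Write `W i` for the age, at the generation of frame `i`, of the latest earlier frame that ever
succeeds, `g i` for the success indicator of frame `i`, and `D i` for its success delay. Between the
arrivals of frames `i` and `i + 1` the age is piecewise linear, and the area under it is `T i * T
(i+1) + T (i+1)^2 / 2 + W i * D i` (`integral_AoPI_between_arrivals`). The age obeys `W (i+1) = T i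
+ (1 - g i) * W i`.

The variables `g i` and `D i` are functions of the block `(T (i+1), O i, B i)`, which is independent
of the past that determines `W i` and `T i` (`indepFun_pastInfo_serviceBlock`). Hence the sums of `W
i * (g i - q)`, `W i * (D i - c)` and `T i * (T (i+1) - 1/lam)` have orthogonal increments, bounded
in L² because `W` is; divided by `n` they vanish almost surely along `n = k^2`
(`ae_tendsto_sum_mul_centered`). Telescoping the recursion turns `∑ W i * g i` into `∑ T i` up to
boundary terms, so `W` has average `1 / (lam * q)`.

Memorylessness gives `q = p * mu / (lam + mu)` and `c = (1 - q) / lam`. The mean area per frame is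
therefore `2 / lam^2 + c / (lam * q)`; divided by the mean spacing `1 / lam` it is `1 / lam + 1 /
(lam * q)`, the asserted value. Squares suffice because the accumulated area is monotone and
`(k+1)^2 / k^2` tends to 1. -/

/-! ### Independence and an L² law of large numbers along squares -/

/-- If `A` is independent of `(B, C)` and `B` is independent of `C`, then `(A, B)` is independent
of `C`. -/
lemma indepFun_prodMk_left_of_prodMk_right {Ω α β γ : Type*} {mΩ : MeasurableSpace Ω}
    [MeasurableSpace α] [MeasurableSpace β] [MeasurableSpace γ] {P : Measure Ω}
    [IsProbabilityMeasure P] {A : Ω → α} {B : Ω → β} {C : Ω → γ}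
    (hA : Measurable A) (hB : Measurable B) (hC : Measurable C)
    (h : IndepFun A (fun ω => (B ω, C ω)) P) (hBC : IndepFun B C P) :
    IndepFun (fun ω => (A ω, B ω)) C P := by
  have := Measure.isProbabilityMeasure_map (μ := P) hA.aemeasurable
  have := Measure.isProbabilityMeasure_map (μ := P) hB.aemeasurable
  have := Measure.isProbabilityMeasure_map (μ := P) hC.aemeasurable
  have hAB : IndepFun A B P := h.comp measurable_id measurable_fst
  rw [indepFun_iff_map_prod_eq_prod_map_map (by fun_prop) (by fun_prop)] at h hBC hAB ⊢
  have e : (fun ω => ((A ω, B ω), C ω))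
      = (MeasurableEquiv.prodAssoc (α := α) (β := β) (γ := γ)).symm
        ∘ (fun ω => (A ω, (B ω, C ω))) := rfl
  rw [e, ← Measure.map_map (by fun_prop) (by fun_prop), h, hBC, hAB]
  rw [← (measurePreserving_prodAssoc (P.map A) (P.map B) (P.map C)).map_eq,
    Measure.map_map (by fun_prop) (by fun_prop)]
  simp

/-- Random variables with summable second moments tend to zero almost surely. -/
lemma ae_tendsto_zero_of_summable_integral_sq {Ω : Type*} {mΩ : MeasurableSpace Ω} {P : Measure Ω}
    {Z : ℕ → Ω → ℝ} {a : ℕ → ℝ} (hZ : ∀ k, MemLp (Z k) 2 P)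
    (hle : ∀ k, ∫ ω, Z k ω ^ 2 ∂P ≤ a k) (ha : Summable a) :
    ∀ᵐ ω ∂P, Tendsto (fun k => Z k ω) atTop (𝓝 0) := by
  have hs : Summable (fun k => ∫ ω, Z k ω ^ 2 ∂P) :=
    ha.of_nonneg_of_le (fun k => integral_nonneg fun ω => sq_nonneg _) hle
  have hmeas : ∀ k, AEMeasurable (fun ω => ENNReal.ofReal (Z k ω ^ 2)) P := fun k =>
    ((hZ k).aestronglyMeasurable.aemeasurable.pow_const 2).ennreal_ofReal
  have hfin : ∫⁻ ω, ∑' k, ENNReal.ofReal (Z k ω ^ 2) ∂P ≠ ⊤ := by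
    rw [lintegral_tsum hmeas]
    have : ∀ k, ∫⁻ ω, ENNReal.ofReal (Z k ω ^ 2) ∂P = ENNReal.ofReal (∫ ω, Z k ω ^ 2 ∂P) :=
      fun k => (ofReal_integral_eq_lintegral_ofReal (hZ k).integrable_sq
        (Eventually.of_forall fun ω => sq_nonneg _)).symm
    simp_rw [this]
    exact hs.tsum_ofReal_ne_top
  filter_upwards [ae_lt_top' (AEMeasurable.tsum hmeas) hfin] with ω hω
  have h1 := ENNReal.tendsto_atTop_zero_of_tsum_ne_top hω.ne
  have h2 : Tendsto (fun k => Z k ω ^ 2) atTop (𝓝 0) := by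
    have := (ENNReal.tendsto_toReal ENNReal.zero_ne_top).comp h1
    simpa [Function.comp_def, ENNReal.toReal_ofReal (sq_nonneg _)] using this
  have h3 := h2.sqrt
  simp only [Real.sqrt_sq_eq_abs, Real.sqrt_zero] at h3
  exact (tendsto_zero_iff_abs_tendsto_zero _).2 h3

/-- Orthogonality kills the cross terms, so the second moment of the sum grows only linearly; after
division by `n ^ 2` it is summable along `n = k ^ 2`. -/
lemma integral_sq_sum_le {Ω : Type*} {mΩ : MeasurableSpace Ω} {P : Measure Ω}
    {D : ℕ → Ω → ℝ} {C : ℝ} (hD : ∀ i, MemLp (D i) 2 P)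
    (horth : ∀ i j, i < j → ∫ ω, D i ω * D j ω ∂P = 0)
    (hC : ∀ i, ∫ ω, D i ω ^ 2 ∂P ≤ C) (n : ℕ) :
    ∫ ω, (∑ i ∈ Finset.range n, D i ω) ^ 2 ∂P ≤ n * C := by
  induction n with
  | zero => simp
  | succ n ih =>
    have hint : ∀ i j, Integrable (fun ω => D i ω * D j ω) P := fun i j =>
      (hD i).integrable_mul (hD j)
    have hS : MemLp (fun ω => ∑ i ∈ Finset.range n, D i ω) 2 P :=
      memLp_finsetSum _ fun i _ => hD i
    have e : ∀ ω, (∑ i ∈ Finset.range (n + 1), D i ω) ^ 2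
        = (∑ i ∈ Finset.range n, D i ω) ^ 2 + 2 * ∑ i ∈ Finset.range n, D i ω * D n ω
          + D n ω ^ 2 := fun ω => by
      rw [Finset.sum_range_succ, ← Finset.sum_mul]; ring
    have hc : Integrable (fun ω => ∑ i ∈ Finset.range n, D i ω * D n ω) P :=
      integrable_finsetSum _ fun i _ => hint i n
    have hSc : Integrable (fun ω => (∑ i ∈ Finset.range n, D i ω) ^ 2
        + 2 * ∑ i ∈ Finset.range n, D i ω * D n ω) P := hS.integrable_sq.add (hc.const_mul 2)
    simp_rw [e]
    rw [integral_add hSc (hD n).integrable_sq,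
      integral_add hS.integrable_sq (hc.const_mul 2), integral_const_mul,
      integral_finsetSum _ fun i _ => hint i n,
      Finset.sum_eq_zero fun i hi => horth i n (Finset.mem_range.1 hi)]
    push_cast
    linarith [hC n]

/-- Strong law of large numbers, along the squares, for orthogonal sequences bounded in `L²`. -/
lemma ae_tendsto_sum_sq_of_orthogonal {Ω : Type*} {mΩ : MeasurableSpace Ω} {P : Measure Ω}
    {D : ℕ → Ω → ℝ} {C : ℝ} (hD : ∀ i, MemLp (D i) 2 P)
    (horth : ∀ i j, i < j → ∫ ω, D i ω * D j ω ∂P = 0)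
    (hC : ∀ i, ∫ ω, D i ω ^ 2 ∂P ≤ C) :
    ∀ᵐ ω ∂P, Tendsto (fun k : ℕ => (∑ i ∈ Finset.range (k ^ 2), D i ω) / (k : ℝ) ^ 2)
      atTop (𝓝 0) := by
  refine ae_tendsto_zero_of_summable_integral_sq (a := fun k => C * (1 / (k : ℝ) ^ 2)) ?_ ?_
    ((Real.summable_one_div_nat_pow.2 one_lt_two).mul_left C)
  · intro k
    simp_rw [div_eq_inv_mul]
    exact (memLp_finsetSum _ fun i _ => hD i).const_mul _
  · intro k
    have := integral_sq_sum_le hD horth hC (k ^ 2)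
    simp_rw [div_pow, integral_div]
    rcases eq_or_ne k 0 with rfl | hk
    · simp
    have hk' : (0 : ℝ) < (k : ℝ) ^ 2 := by positivity
    rw [div_le_iff₀ (by positivity)]
    push_cast at this
    calc _ ≤ _ := this
      _ = _ := by field_simp

/-! ### The exponential law -/

lemma measurable_gammaPDF (a r : ℝ) : Measurable (gammaPDF a r) :=
  (measurable_gammaPDFReal a r).ennreal_ofReal

lemma integral_expMeasure {r : ℝ} (hr : 0 < r) (f : ℝ → ℝ) :
    ∫ x, f x ∂(expMeasure r) = ∫ x in Set.Ioi 0, f x * (r * Real.exp (-(r * x))) := by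
  rw [expMeasure, gammaMeasure, integral_withDensity_eq_integral_toReal_smul
    (measurable_gammaPDF 1 r) (Eventually.of_forall fun x => by simp [gammaPDF]),
    ← integral_Ici_eq_integral_Ioi, ← integral_indicator measurableSet_Ici]
  congr 1 with x
  by_cases hx : 0 ≤ x
  · rw [gammaPDF_of_nonneg hx, ENNReal.toReal_ofReal (by positivity)]
    simp [Set.indicator, hx]; ring
  · rw [gammaPDF_of_neg (not_le.1 hx)]; simp [Set.indicator, hx]

lemma ae_pos_expMeasure (r : ℝ) : ∀ᵐ x ∂(expMeasure r), 0 < x := by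
  rw [expMeasure, gammaMeasure, ae_withDensity_iff (measurable_gammaPDF 1 r)]
  filter_upwards [Measure.ae_ne volume (0 : ℝ)] with x hx h
  by_contra! hx'
  exact h (gammaPDF_of_neg (lt_of_le_of_ne hx' hx))

lemma integral_pow_expMeasure {r : ℝ} (hr : 0 < r) (n : ℕ) :
    ∫ x, x ^ n ∂(expMeasure r) = n.factorial / r ^ n := by
  have h := Real.integral_rpow_mul_exp_neg_mul_Ioi (a := n + 1) (by positivity) hr
  rw [integral_expMeasure hr]
  have : ∀ x : ℝ, x ^ n * (r * Real.exp (-(r * x)))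
      = r * (x ^ ((n : ℝ) + 1 - 1) * Real.exp (-(r * x))) := fun x => by
    rw [add_sub_cancel_right, Real.rpow_natCast]; ring
  simp_rw [this]
  rw [integral_const_mul, h, Real.Gamma_nat_eq_factorial]
  have : ((n : ℝ) + 1) = ((n + 1 : ℕ) : ℝ) := by push_cast; rfl
  rw [this, Real.rpow_natCast, one_div, inv_pow, pow_succ]
  field_simp

lemma integrable_pow_expMeasure {r : ℝ} (hr : 0 < r) (n : ℕ) :
    Integrable (fun x : ℝ => x ^ n) (expMeasure r) := by
  -- A non-integrable function has integral 0 by convention, whereas the moment just computed is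
  -- positive.
  by_contra h
  have := integral_undef h
  rw [integral_pow_expMeasure hr] at this
  have : (0 : ℝ) < n.factorial / r ^ n := by positivity
  linarith

lemma integral_id_expMeasure {r : ℝ} (hr : 0 < r) : ∫ x, x ∂(expMeasure r) = 1 / r := by
  simpa using integral_pow_expMeasure hr 1

lemma integrable_id_expMeasure {r : ℝ} (hr : 0 < r) :
    Integrable (fun x : ℝ => x) (expMeasure r) := by
  simpa using integrable_pow_expMeasure hr 1

lemma memLp_id_expMeasure {r : ℝ} (hr : 0 < r) : MemLp (fun x : ℝ => x) 2 (expMeasure r) :=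
  (memLp_two_iff_integrable_sq (by fun_prop)).2 (integrable_pow_expMeasure hr 2)

/-- Memorylessness of the exponential law. -/
lemma integral_comp_sub_expMeasure {r o : ℝ} (hr : 0 < r) (ho : 0 ≤ o) {f : ℝ → ℝ}
    (hf : ∀ x ≤ 0, f x = 0) :
    ∫ x, f (x - o) ∂(expMeasure r) = Real.exp (-(r * o)) * ∫ x, f x ∂(expMeasure r) := by
  -- Both integrands vanish off the half-line because `f` does, so they may be integrated over all
  -- of `ℝ`, where translation by `o` is free.
  rw [integral_expMeasure hr, integral_expMeasure hr, ← integral_const_mul,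
    setIntegral_eq_integral_of_forall_compl_eq_zero,
    setIntegral_eq_integral_of_forall_compl_eq_zero,
    ← integral_sub_right_eq_self (fun x => Real.exp (-(r * o)) * _) o]
  · congr 1 with x
    rw [show -(r * x) = -(r * o) + -(r * (x - o)) by ring, Real.exp_add]; ring
  · intro x hx; rw [hf x (not_lt.1 hx)]; simp
  · intro x hx
    have : x ≤ 0 := not_lt.1 hx
    rw [hf _ (by linarith)]; simp

lemma integral_exp_neg_expMeasure {r s : ℝ} (hr : 0 < r) (hs : 0 < s) :
    ∫ x, Real.exp (-(r * x)) ∂(expMeasure s) = s / (r + s) := by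
  rw [integral_expMeasure hs]
  have : ∀ x : ℝ, Real.exp (-(r * x)) * (s * Real.exp (-(s * x)))
      = s * Real.exp (-(r + s) * x) := fun x => by
    rw [mul_left_comm, ← Real.exp_add]; ring_nf
  simp_rw [this]
  rw [integral_const_mul, integral_exp_mul_Ioi (by linarith)]
  simp only [mul_zero, Real.exp_zero, neg_div_neg_eq]
  rw [mul_one_div]

/-! ### Success probability and mean delay of one service block -/

/-- The joint law of two independent exponential times and of an independent Bernoulli trial. -/
noncomputable def expExpBernoulli (lam mu : ℝ) (p : unitInterval) : Measure (ℝ × ℝ × Bool) :=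
  (expMeasure lam).prod ((expMeasure mu).prod (bernoulliMeasure true false p))

lemma isProbabilityMeasure_expExpBernoulli {lam mu : ℝ} (hlam : 0 < lam) (hmu : 0 < mu)
    (p : unitInterval) : IsProbabilityMeasure (expExpBernoulli lam mu p) := by
  have := isProbabilityMeasure_expMeasure hlam
  have := isProbabilityMeasure_expMeasure hmu
  rw [expExpBernoulli]; infer_instance

lemma measurePreserving_fst_expExpBernoulli {lam mu : ℝ} (hmu : 0 < mu)
    (hlam : 0 < lam) (p : unitInterval) :
    MeasurePreserving (fun x : ℝ × ℝ × Bool => x.1) (expExpBernoulli lam mu p) (expMeasure lam) := by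
  have := isProbabilityMeasure_expMeasure hlam
  have := isProbabilityMeasure_expMeasure hmu
  exact measurePreserving_fst

lemma measurePreserving_snd_fst_expExpBernoulli {lam mu : ℝ} (hlam : 0 < lam)
    (hmu : 0 < mu) (p : unitInterval) :
    MeasurePreserving (fun x : ℝ × ℝ × Bool => x.2.1) (expExpBernoulli lam mu p)
      (expMeasure mu) := by
  have := isProbabilityMeasure_expMeasure hlam
  have := isProbabilityMeasure_expMeasure hmu
  exact measurePreserving_fst.comp measurePreserving_snd

/-- The indicator that a computation succeeds before the next transmission is over. -/
noncomputable def successIndicator (x : ℝ × ℝ × Bool) : ℝ :=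
  if x.2.1 < x.1 ∧ x.2.2 = true then 1 else 0

/-- The computation time if the computation succeeds, the next transmission time otherwise. -/
noncomputable def successDelay (x : ℝ × ℝ × Bool) : ℝ :=
  if x.2.1 < x.1 ∧ x.2.2 = true then x.2.1 else x.1

lemma measurableSet_success : MeasurableSet {x : ℝ × ℝ × Bool | x.2.1 < x.1 ∧ x.2.2 = true} :=
  (measurableSet_lt (f := fun x : ℝ × ℝ × Bool => x.2.1) (g := fun x => x.1)
    (by fun_prop) (by fun_prop)).inter
      ((by fun_prop : Measurable fun x : ℝ × ℝ × Bool => x.2.2) (measurableSet_singleton true))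

lemma measurable_successIndicator : Measurable successIndicator :=
  Measurable.ite measurableSet_success measurable_const measurable_const

lemma measurable_successDelay : Measurable successDelay :=
  Measurable.ite measurableSet_success (by fun_prop) (by fun_prop)

lemma successIndicator_nonneg (x : ℝ × ℝ × Bool) : 0 ≤ successIndicator x := by
  unfold successIndicator; split_ifs <;> simp

lemma successIndicator_le_one (x : ℝ × ℝ × Bool) : successIndicator x ≤ 1 := by
  unfold successIndicator; split_ifs <;> simp

lemma successIndicator_sq (x : ℝ × ℝ × Bool) : successIndicator x ^ 2 = successIndicator x := by
  unfold successIndicator; split_ifs <;> simp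

lemma abs_successDelay_le (x : ℝ × ℝ × Bool) : |successDelay x| ≤ |x.1| + |x.2.1| := by
  unfold successDelay; split_ifs
  · linarith [abs_nonneg x.1]
  · linarith [abs_nonneg x.2.1]

/-- Given the computation time `o`, memorylessness yields the factor `exp (-(lam * o))`, whose mean
under `Exp(mu)` is `mu / (lam + mu)`. An indicator for `f` gives the success probability, a positive
part gives the mean delay. -/
lemma integral_excess_expExpBernoulli {lam mu : ℝ} (hlam : 0 < lam) (hmu : 0 < mu)
    (p : unitInterval) {f : ℝ → ℝ} (hf : ∀ x ≤ 0, f x = 0)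
    (hint : Integrable (fun x : ℝ × ℝ × Bool => f (x.1 - x.2.1) * if x.2.2 then 1 else 0)
      (expExpBernoulli lam mu p)) :
    ∫ x, f (x.1 - x.2.1) * (if x.2.2 then 1 else 0) ∂(expExpBernoulli lam mu p)
      = p * (mu / (lam + mu)) * ∫ x, f x ∂(expMeasure lam) := by
  have := isProbabilityMeasure_expMeasure hlam
  have := isProbabilityMeasure_expMeasure hmu
  rw [expExpBernoulli] at hint ⊢
  rw [integral_prod_symm _ hint]
  simp only
  have hae : ∀ᵐ y ∂((expMeasure mu).prod (bernoulliMeasure true false p)),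
      ∫ x, f (x - y.1) * (if y.2 then 1 else 0) ∂(expMeasure lam)
        = (Real.exp (-(lam * y.1)) * ∫ x, f x ∂(expMeasure lam)) * (if y.2 then 1 else 0) := by
    filter_upwards [measurePreserving_fst.quasiMeasurePreserving.ae (ae_pos_expMeasure mu)]
      with y hy
    rw [integral_mul_const, integral_comp_sub_expMeasure hlam hy.le hf]
  rw [integral_congr_ae hae,
    integral_prod_mul (fun o => Real.exp (-(lam * o)) * ∫ x, f x ∂(expMeasure lam))
      (fun b : Bool => (if b then 1 else 0 : ℝ)),
    integral_mul_const, integral_exp_neg_expMeasure hlam hmu, integral_bernoulliMeasure]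
  simp; ring

lemma integrable_successIndicator {lam mu : ℝ} (hlam : 0 < lam) (hmu : 0 < mu)
    (p : unitInterval) :
    Integrable successIndicator (expExpBernoulli lam mu p) := by
  have := isProbabilityMeasure_expExpBernoulli hlam hmu p
  refine Integrable.of_bound measurable_successIndicator.aestronglyMeasurable 1
    (Eventually.of_forall fun x => ?_)
  rw [Real.norm_of_nonneg (successIndicator_nonneg x)]
  exact successIndicator_le_one x

lemma integral_successIndicator {lam mu : ℝ} (hlam : 0 < lam) (hmu : 0 < mu)
    (p : unitInterval) :
    ∫ x, successIndicator x ∂(expExpBernoulli lam mu p) = p * (mu / (lam + mu)) := by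
  have e : ∀ x : ℝ × ℝ × Bool, successIndicator x
      = (Set.Ioi (0 : ℝ)).indicator (fun _ => (1 : ℝ)) (x.1 - x.2.1) * if x.2.2 then 1 else 0 := by
    rintro ⟨t, o, b⟩
    cases b <;> by_cases h : o < t <;> simp [successIndicator, Set.indicator, h]
  have hint := integrable_successIndicator hlam hmu p
  rw [funext e] at hint
  rw [funext e, integral_excess_expExpBernoulli hlam hmu p (by simp +contextual) hint]
  have := isProbabilityMeasure_expMeasure hlam
  rw [integral_congr_ae (g := fun _ => (1 : ℝ))]
  · simp
  · filter_upwards [ae_pos_expMeasure lam] with x hx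
    simp [hx]

lemma memLp_successDelay {lam mu : ℝ} (hlam : 0 < lam) (hmu : 0 < mu)
    (p : unitInterval) : MemLp successDelay 2 (expExpBernoulli lam mu p) := by
  have h1 := (memLp_id_expMeasure hlam).comp_measurePreserving
    (measurePreserving_fst_expExpBernoulli hmu hlam p)
  have h2 := (memLp_id_expMeasure hmu).comp_measurePreserving
    (measurePreserving_snd_fst_expExpBernoulli hlam hmu p)
  refine (h1.norm.add h2.norm).mono' measurable_successDelay.aestronglyMeasurable
    (Eventually.of_forall fun x => ?_)
  exact abs_successDelay_le x

/-- The delay is the transmission time minus, on accurate frames, the excess `(T - O)⁺`. By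
memorylessness the excess, when positive, is again `Exp(lam)`. -/
lemma integral_successDelay {lam mu : ℝ} (hlam : 0 < lam) (hmu : 0 < mu)
    (p : unitInterval) :
    ∫ x, successDelay x ∂(expExpBernoulli lam mu p)
      = (1 - p * (mu / (lam + mu))) * (1 / lam) := by
  have := isProbabilityMeasure_expExpBernoulli hlam hmu p
  have := isProbabilityMeasure_expMeasure hlam
  have hT := measurePreserving_fst_expExpBernoulli hmu hlam p
  have e : ∀ x : ℝ × ℝ × Bool, successDelay x
      = x.1 - max (x.1 - x.2.1) 0 * if x.2.2 then 1 else 0 := by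
    rintro ⟨t, o, b⟩
    cases b
    · simp [successDelay]
    · by_cases h : o < t
      · simp [successDelay, h, max_eq_left (sub_nonneg.2 h.le)]
      · simp [successDelay, h, max_eq_right (sub_nonpos.2 (not_lt.1 h))]
  have h1 : Integrable (fun x : ℝ × ℝ × Bool => x.1) (expExpBernoulli lam mu p) :=
    hT.integrable_comp_of_integrable (integrable_id_expMeasure hlam)
  have h2 : Integrable (fun x : ℝ × ℝ × Bool => max (x.1 - x.2.1) 0 * if x.2.2 then 1 else 0)
      (expExpBernoulli lam mu p) := by
    refine (h1.sub ((memLp_successDelay hlam hmu p).integrable one_le_two)).congr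
      (Eventually.of_forall fun x => ?_)
    simp [e x]
  have h3 : ∫ x : ℝ × ℝ × Bool, x.1 ∂(expExpBernoulli lam mu p) = 1 / lam := by
    rw [← integral_id_expMeasure hlam, ← hT.map_eq,
      integral_map hT.measurable.aemeasurable (by fun_prop)]
  have h4 : ∫ x, max x 0 ∂(expMeasure lam) = 1 / lam := by
    rw [← integral_id_expMeasure hlam]
    refine integral_congr_ae ?_
    filter_upwards [ae_pos_expMeasure lam] with x hx using max_eq_left hx.le
  rw [funext e, integral_sub h1 h2, h3,
    integral_excess_expExpBernoulli hlam hmu p (f := fun x => max x 0)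
      (fun x hx => max_eq_right hx) h2, h4]
  ring

/-! ### The age recursion, its filtration and the martingale sums -/

/-- The next transmission time together with the computation time and the accuracy of frame `i`. -/
def serviceBlock (x : ℕ → ℝ × ℝ × Bool) (i : ℕ) : ℝ × ℝ × Bool := ((x (i + 1)).1, (x i).2)

/-- The age, at the generation of frame `i`, of the latest frame before `i` that succeeds. -/
noncomputable def ageAtGeneration (a₀ : ℝ) (x : ℕ → ℝ × ℝ × Bool) : ℕ → ℝ
  | 0 => a₀
  | i + 1 => (x i).1 + (1 - successIndicator (serviceBlock x i)) * ageAtGeneration a₀ x i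

/-- The information carried by the frames before `i` and by the transmission time of frame `i`. -/
@[reducible] def pastInfo {Ω : Type*} (X : ℕ → Ω → ℝ × ℝ × Bool) (i : ℕ) : MeasurableSpace Ω :=
  MeasurableSpace.comap (fun ω => ((fun k : Finset.range i => X k ω), (X i ω).1)) inferInstance

lemma memLp_mul_of_indepFun {Ω : Type*} {mΩ : MeasurableSpace Ω} {P : Measure Ω}
    {U V : Ω → ℝ}
    (h : IndepFun U V P) (hU : MemLp U 2 P) (hV : MemLp V 2 P) : MemLp (fun ω => U ω * V ω) 2 P := by
  refine (memLp_two_iff_integrable_sq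
    (hU.aestronglyMeasurable.mul hV.aestronglyMeasurable)).2 ?_
  have := (h.comp (φ := fun x => x ^ 2) (ψ := fun x => x ^ 2) (by fun_prop)
    (by fun_prop)).integrable_mul hU.integrable_sq hV.integrable_sq
  simpa [mul_pow, Function.comp_def, Pi.mul_def] using this

section

variable {Ω : Type*} {X : ℕ → Ω → ℝ × ℝ × Bool}

lemma measurable_pastInfo_fst (i : ℕ) : Measurable[pastInfo X i] fun ω => (X i ω).1 :=
  measurable_snd.comp (comap_measurable _)

lemma measurable_pastInfo_of_lt {k i : ℕ} (h : k < i) : Measurable[pastInfo X i] (X k) :=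
  (by fun_prop : Measurable fun z : (Finset.range i → ℝ × ℝ × Bool) × ℝ =>
    z.1 ⟨k, Finset.mem_range.2 h⟩).comp (comap_measurable _)

lemma pastInfo_le_iff {i : ℕ} {m : MeasurableSpace Ω} :
    pastInfo X i ≤ m ↔ (∀ k < i, Measurable[m] (X k)) ∧ Measurable[m] fun ω => (X i ω).1 := by
  constructor
  · exact fun h => ⟨fun k hk => (measurable_pastInfo_of_lt hk).mono h le_rfl,
      (measurable_pastInfo_fst i).mono h le_rfl⟩
  · rintro ⟨h1, h2⟩
    refine Measurable.comap_le (Measurable.prodMk ?_ h2)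
    exact measurable_pi_lambda _ fun k => h1 k (Finset.mem_range.1 k.2)

lemma pastInfo_mono : Monotone (pastInfo X) := by
  refine monotone_nat_of_le_succ fun i => pastInfo_le_iff.2 ⟨fun k hk => ?_, ?_⟩
  · exact measurable_pastInfo_of_lt (hk.trans i.lt_succ_self)
  · exact measurable_fst.comp (measurable_pastInfo_of_lt i.lt_succ_self)

lemma measurable_pastInfo_serviceBlock (i : ℕ) :
    Measurable[pastInfo X (i + 1)] fun ω => serviceBlock (fun k => X k ω) i :=
  (measurable_pastInfo_fst (i + 1)).prodMk
    (measurable_snd.comp (measurable_pastInfo_of_lt i.lt_succ_self))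

lemma measurable_pastInfo_ageAtGeneration (a₀ : ℝ) (i : ℕ) :
    Measurable[pastInfo X i] fun ω => ageAtGeneration a₀ (fun k => X k ω) i := by
  induction i with
  | zero => exact measurable_const
  | succ i ih =>
    have h1 : Measurable[pastInfo X (i + 1)] fun ω => (X i ω).1 :=
      measurable_fst.comp (measurable_pastInfo_of_lt i.lt_succ_self)
    have h2 := ih.mono (pastInfo_mono i.le_succ) le_rfl
    have h3 := measurable_successIndicator.comp (measurable_pastInfo_serviceBlock (X := X) i)
    exact h1.add ((h3.const_sub 1).mul h2)

variable {mΩ : MeasurableSpace Ω} {P : Measure Ω} [IsProbabilityMeasure P]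

/-- The past and block `i` both involve frame `i`, but the past uses only its transmission time and
the block only the other two components; these are independent by `hsplit`. The remaining component
of the block comes from the fresh frame `i + 1`. -/
lemma indepFun_pastInfo_serviceBlock (hX : ∀ i, Measurable (X i)) (hindep : iIndepFun X P)
    (hsplit : ∀ i, IndepFun (fun ω => (X i ω).1) (fun ω => (X i ω).2) P)
    {β γ : Type*} [MeasurableSpace β] [MeasurableSpace γ] {i : ℕ} {f : Ω → β}
    (hf : Measurable[pastInfo X i] f) {φ : ℝ × ℝ × Bool → γ} (hφ : Measurable φ) :
    IndepFun f (fun ω => φ (serviceBlock (fun k => X k ω) i)) P := by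
  have h1 : IndepFun (fun ω (k : Finset.range i) => X k ω) (X i) P :=
    (hindep.indepFun_finset (Finset.range i) {i} (by simp) hX).comp measurable_id
      (measurable_pi_apply (⟨i, Finset.mem_singleton_self i⟩ : ({i} : Finset ℕ)))
  have h2 : IndepFun (fun ω (k : Finset.range (i + 1)) => X k ω) (X (i + 1)) P :=
    (hindep.indepFun_finset (Finset.range (i + 1)) {i + 1} (by simp) hX).comp measurable_id
      (measurable_pi_apply (⟨i + 1, Finset.mem_singleton_self (i + 1)⟩ : ({i + 1} : Finset ℕ)))
  have hH : Measurable fun ω (k : Finset.range i) => X k ω := by fun_prop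
  have h3 := indepFun_prodMk_left_of_prodMk_right hH (hX i).fst (hX i).snd h1 (hsplit i)
  have h4 : IndepFun (fun ω => (X (i + 1) ω).1)
      (fun ω => ((X i ω).2, ((fun k : Finset.range i => X k ω), (X i ω).1))) P := by
    refine (h2.comp (φ := fun z : Finset.range (i + 1) → ℝ × ℝ × Bool =>
      ((z ⟨i, by simp⟩).2, ((fun k : Finset.range i => z ⟨k, by
        have := Finset.mem_range.1 k.2; simp; omega⟩), (z ⟨i, by simp⟩).1)))
      (ψ := Prod.fst) (by fun_prop) measurable_fst).symm
  -- Regrouping `h4` by means of `h3` puts the whole block on one side and the whole past on the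
  -- other.
  have h5 := indepFun_prodMk_left_of_prodMk_right (hX (i + 1)).fst (hX i).snd
    (hH.prodMk (hX i).fst) h4 h3.symm
  rw [IndepFun_iff_Indep] at h5 ⊢
  refine indep_of_indep_of_le h5.symm hf.comap_le ?_
  exact (hφ.comp (comap_measurable _)).comap_le

lemma hasLaw_serviceBlock {α : Measure ℝ} {β : Measure (ℝ × Bool)} [IsProbabilityMeasure α]
    [IsProbabilityMeasure β] (hindep : iIndepFun X P) (hlaw : ∀ i, HasLaw (X i) (α.prod β) P)
    (i : ℕ) : HasLaw (fun ω => serviceBlock (fun k => X k ω) i) (α.prod β) P := by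
  have h : IndepFun (fun ω => (X (i + 1) ω).1) (fun ω => (X i ω).2) P :=
    (hindep.indepFun (Nat.succ_ne_self i)).comp measurable_fst measurable_snd
  exact h.hasLaw_prod (measurePreserving_fst.fun_comp_hasLaw (hlaw (i + 1)))
    (measurePreserving_snd.fun_comp_hasLaw (hlaw i))

lemma indepFun_fst_snd_of_hasLaw_prod {α : Measure ℝ} {β : Measure (ℝ × Bool)}
    [IsProbabilityMeasure α] [IsProbabilityMeasure β] {Y : Ω → ℝ × ℝ × Bool}
    (hlaw : HasLaw Y (α.prod β) P) :
    IndepFun (fun ω => (Y ω).1) (fun ω => (Y ω).2) P :=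
  (indepFun_iff_hasLaw_prodMk_prod (measurePreserving_fst.fun_comp_hasLaw hlaw)
    (measurePreserving_snd.fun_comp_hasLaw hlaw)).2 hlaw

/-- Law of large numbers, along the squares, for the martingale with increments
`V i * (φ (block i) - E φ)`. -/
lemma ae_tendsto_sum_mul_centered {α : Measure ℝ} {β : Measure (ℝ × Bool)}
    [IsProbabilityMeasure α] [IsProbabilityMeasure β]
    (hX : ∀ i, Measurable (X i)) (hindep : iIndepFun X P)
    (hlaw : ∀ i, HasLaw (X i) (α.prod β) P) {V : ℕ → Ω → ℝ} {C : ℝ}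
    (hVm : ∀ i, Measurable[pastInfo X i] (V i)) (hV : ∀ i, MemLp (V i) 2 P)
    (hC : ∀ i, ∫ ω, V i ω ^ 2 ∂P ≤ C) {φ : ℝ × ℝ × Bool → ℝ} (hφm : Measurable φ)
    (hφ : MemLp φ 2 (α.prod β)) :
    ∀ᵐ ω ∂P, Tendsto (fun k : ℕ => (∑ i ∈ Finset.range (k ^ 2),
      V i ω * (φ (serviceBlock (fun k => X k ω) i) - ∫ z, φ z ∂(α.prod β))) / (k : ℝ) ^ 2)
      atTop (𝓝 0) := by
  set c := ∫ z, φ z ∂(α.prod β) with hc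
  have hle : ∀ i, pastInfo X i ≤ mΩ := fun i =>
    pastInfo_le_iff.2 ⟨fun k _ => hX k, (hX i).fst⟩
  have hψm : Measurable fun z => φ z - c := hφm.sub_const c
  have hψ : MemLp (fun z => φ z - c) 2 (α.prod β) := hφ.sub (memLp_const c)
  have hψ0 : ∫ z, (φ z - c) ∂(α.prod β) = 0 := by
    rw [integral_sub (hφ.integrable one_le_two) (integrable_const c)]; simp [hc]
  have hR := hasLaw_serviceBlock hindep hlaw
  have hind : ∀ i (f : Ω → ℝ), Measurable[pastInfo X i] f →
      IndepFun f (fun ω => φ (serviceBlock (fun k => X k ω) i) - c) P := fun i f hf =>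
    indepFun_pastInfo_serviceBlock hX hindep (fun i => indepFun_fst_snd_of_hasLaw_prod (hlaw i))
      hf hψm
  have hξm : ∀ i, Measurable[pastInfo X (i + 1)]
      fun ω => φ (serviceBlock (fun k => X k ω) i) - c := fun i =>
    hψm.comp (measurable_pastInfo_serviceBlock i)
  have hξ : ∀ i, MemLp (fun ω => φ (serviceBlock (fun k => X k ω) i) - c) 2 P := fun i =>
    (((hR i).map_eq ▸ hψ : MemLp (fun z => φ z - c) 2 (P.map _))).comp_of_map (hR i).aemeasurable
  have hDm : ∀ i, Measurable[pastInfo X (i + 1)]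
      fun ω => V i ω * (φ (serviceBlock (fun k => X k ω) i) - c) := fun i =>
    ((hVm i).mono (pastInfo_mono i.le_succ) le_rfl).mul (hξm i)
  refine ae_tendsto_sum_sq_of_orthogonal (C := C * ∫ z, (φ z - c) ^ 2 ∂(α.prod β))
    (fun i => memLp_mul_of_indepFun (hind i _ (hVm i)) (hV i) (hξ i)) ?_ ?_
  -- For `i < j`, everything except the centered factor of index `j` is known to the past of `j`;
  -- that factor is independent of it and has mean zero.
  · intro i j hij
    have hm : Measurable[pastInfo X j]
        fun ω => V i ω * (φ (serviceBlock (fun k => X k ω) i) - c) * V j ω :=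
      ((hDm i).mono (pastInfo_mono hij) le_rfl).mul (hVm j)
    simp_rw [← mul_assoc (V i _ * _)]
    rw [(hind j _ hm).integral_fun_mul_eq_mul_integral
      (hm.mono (hle j) le_rfl).aestronglyMeasurable (hξ j).aestronglyMeasurable]
    have := (hR j).integral_comp hψm.aestronglyMeasurable
    rw [hψ0] at this
    exact mul_eq_zero_of_right _ this
  · intro i
    have h := (hind i _ (hVm i)).comp (φ := fun x => x ^ 2) (ψ := fun x => x ^ 2) (by fun_prop)
      (by fun_prop)
    have h2 := h.integral_mul_eq_mul_integral (hV i).integrable_sq.aestronglyMeasurable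
      (hξ i).integrable_sq.aestronglyMeasurable
    simp only [Function.comp_def, Pi.mul_def] at h2
    simp_rw [mul_pow]
    rw [h2]
    have h3 := (hR i).integral_comp (hψm.pow_const 2).aestronglyMeasurable
    simp only [Function.comp_def] at h3
    rw [h3]
    exact mul_le_mul_of_nonneg_right (hC i) (integral_nonneg fun z => sq_nonneg _)

end

/-! ### Uniform second moment bound for the age -/

section

variable {Ω : Type*} {X : ℕ → Ω → ℝ × ℝ × Bool} {mΩ : MeasurableSpace Ω} {P : Measure Ω}
  [IsProbabilityMeasure P]

/-- Young's inequality with weight `q / 2`. It avoids the cross term of `T i` and `W i`, which need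
not be independent: whether frame `i - 1` succeeds depends on `T i`. -/
lemma ageAtGeneration_succ_sq_le {q : ℝ} (hq : 0 < q) (a₀ : ℝ) (x : ℕ → ℝ × ℝ × Bool) (i : ℕ) :
    ageAtGeneration a₀ x (i + 1) ^ 2 ≤ (1 + 2 / q) * (x i).1 ^ 2
      + (1 + q / 2) * (ageAtGeneration a₀ x i ^ 2 * (1 - successIndicator (serviceBlock x i))) := by
  have hs := successIndicator_sq (serviceBlock x i)
  rw [ageAtGeneration]
  set g := successIndicator (serviceBlock x i)
  set w := ageAtGeneration a₀ x i
  set t := (x i).1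
  -- Completing the square; the last term vanishes because `g` is an indicator.
  have e : (1 + 2 / q) * t ^ 2 + (1 + q / 2) * (w ^ 2 * (1 - g)) - (t + (1 - g) * w) ^ 2
      = (q / 2) * (2 / q * t - (1 - g) * w) ^ 2 + (1 + q / 2) * w ^ 2 * (g - g ^ 2) := by
    field_simp; ring
  have : 0 ≤ (q / 2) * (2 / q * t - (1 - g) * w) ^ 2 := by positivity
  rw [hs, sub_self, mul_zero, add_zero] at e
  linarith

lemma memLp_ageAtGeneration (hX : ∀ i, Measurable (X i)) (hT : ∀ i, MemLp (fun ω => (X i ω).1) 2 P)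
    (a₀ : ℝ) (i : ℕ) : MemLp (fun ω => ageAtGeneration a₀ (fun k => X k ω) i) 2 P := by
  induction i with
  | zero => exact memLp_const a₀
  | succ i ih =>
    refine (hT i).add (ih.mono ?_ (Eventually.of_forall fun ω => ?_))
    · have hm : Measurable fun ω => serviceBlock (fun k => X k ω) i :=
        (hX (i + 1)).fst.prodMk (hX i).snd
      exact ((measurable_successIndicator.comp hm).const_sub 1).aestronglyMeasurable.mul
        ih.aestronglyMeasurable
    · have h0 := successIndicator_nonneg (serviceBlock (fun k => X k ω) i)
      have h1 := successIndicator_le_one (serviceBlock (fun k => X k ω) i)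
      rw [norm_mul, Real.norm_of_nonneg (sub_nonneg.2 h1)]
      exact mul_le_of_le_one_left (norm_nonneg _) (by linarith)

/-- In mean, the weight `1 + q / 2` and the survival factor `1 - q` multiply to at most `1 - q / 2 <
1`, so the second moments satisfy a contracting recursion. -/
lemma exists_integral_sq_ageAtGeneration_le {α : Measure ℝ} {β : Measure (ℝ × Bool)}
    [IsProbabilityMeasure α] [IsProbabilityMeasure β]
    (hX : ∀ i, Measurable (X i)) (hindep : iIndepFun X P)
    (hlaw : ∀ i, HasLaw (X i) (α.prod β) P) (hα : MemLp (fun t : ℝ => t) 2 α)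
    (hq : 0 < ∫ z, successIndicator z ∂(α.prod β)) (a₀ : ℝ) :
    ∃ C, ∀ i, ∫ ω, ageAtGeneration a₀ (fun k => X k ω) i ^ 2 ∂P ≤ C := by
  set q := ∫ z, successIndicator z ∂(α.prod β) with hqdef
  set τ := ∫ t, t ^ 2 ∂α with hτ
  have hτ0 : 0 ≤ τ := integral_nonneg fun t => sq_nonneg t
  have hlawT : ∀ i, HasLaw (fun ω => (X i ω).1) α P := fun i =>
    measurePreserving_fst.fun_comp_hasLaw (hlaw i)
  have hT : ∀ i, MemLp (fun ω => (X i ω).1) 2 P := fun i =>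
    ((hlawT i).map_eq ▸ hα : MemLp (fun t : ℝ => t) 2 (P.map _)).comp_of_map
      (hlawT i).aemeasurable
  have hTsq : ∀ i, ∫ ω, (X i ω).1 ^ 2 ∂P = τ := fun i =>
    (hlawT i).integral_comp (f := fun t => t ^ 2) (by fun_prop)
  have hW := memLp_ageAtGeneration hX hT a₀
  have hg : Integrable successIndicator (α.prod β) :=
    Integrable.of_bound measurable_successIndicator.aestronglyMeasurable 1
      (Eventually.of_forall fun z => by
        rw [Real.norm_of_nonneg (successIndicator_nonneg z)]; exact successIndicator_le_one z)
  have hR := hasLaw_serviceBlock hindep hlaw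
  have hgi : ∀ i, Integrable (fun ω => 1 - successIndicator (serviceBlock (fun k => X k ω) i)) P :=
    fun i => by
      have hg' := hg
      rw [← (hR i).map_eq] at hg'
      exact (integrable_const 1).sub (hg'.comp_aemeasurable (hR i).aemeasurable)
  have hgint : ∀ i, ∫ ω, (1 - successIndicator (serviceBlock (fun k => X k ω) i)) ∂P = 1 - q :=
    fun i => by
      have := (hR i).integral_comp (f := fun z => 1 - successIndicator z)
        (measurable_successIndicator.const_sub 1).aestronglyMeasurable
      simp only [Function.comp_def] at this
      rw [this, integral_sub (integrable_const 1) hg]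
      simp [hqdef]
  have hind : ∀ i, IndepFun (fun ω => ageAtGeneration a₀ (fun k => X k ω) i ^ 2)
      (fun ω => 1 - successIndicator (serviceBlock (fun k => X k ω) i)) P := fun i =>
    indepFun_pastInfo_serviceBlock hX hindep (fun i => indepFun_fst_snd_of_hasLaw_prod (hlaw i))
      ((measurable_pastInfo_ageAtGeneration a₀ i).pow_const 2)
      (measurable_successIndicator.const_sub 1)
  -- The second entry is the fixed point of `m ↦ (1 + 2 / q) * τ + (1 - q / 2) * m`; the first
  -- covers the initial age.
  refine ⟨max (a₀ ^ 2) ((1 + 2 / q) * τ * (2 / q)), fun i => ?_⟩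
  induction i with
  | zero => simp [ageAtGeneration]
  | succ i ih =>
    set C := max (a₀ ^ 2) ((1 + 2 / q) * τ * (2 / q))
    have hC : (1 + 2 / q) * τ * (2 / q) ≤ C := le_max_right _ _
    have hC0 : 0 ≤ C := (sq_nonneg a₀).trans (le_max_left _ _)
    have hprod : Integrable (fun ω => ageAtGeneration a₀ (fun k => X k ω) i ^ 2
        * (1 - successIndicator (serviceBlock (fun k => X k ω) i))) P :=
      (hind i).integrable_mul (hW i).integrable_sq (hgi i)
    have h1 : ∫ ω, ageAtGeneration a₀ (fun k => X k ω) (i + 1) ^ 2 ∂P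
        ≤ (1 + 2 / q) * τ + (1 + q / 2)
          * ((∫ ω, ageAtGeneration a₀ (fun k => X k ω) i ^ 2 ∂P) * (1 - q)) := by
      refine (integral_mono (hW (i + 1)).integrable_sq
        (((hT i).integrable_sq.const_mul (1 + 2 / q)).add (hprod.const_mul (1 + q / 2)))
        (fun ω => ageAtGeneration_succ_sq_le hq a₀ (fun k => X k ω) i)).trans_eq ?_
      simp only [Pi.add_apply]
      rw [integral_add ((hT i).integrable_sq.const_mul _) (hprod.const_mul _), integral_const_mul,
        integral_const_mul, hTsq, (hind i).integral_fun_mul_eq_mul_integral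
          (hW i).integrable_sq.aestronglyMeasurable (hgi i).aestronglyMeasurable, hgint]
    have h2 : (1 + 2 / q) * τ ≤ C * (q / 2) := by
      calc (1 + 2 / q) * τ = (1 + 2 / q) * τ * (2 / q) * (q / 2) := by field_simp
        _ ≤ C * (q / 2) := by gcongr
    set m := ∫ ω, ageAtGeneration a₀ (fun k => X k ω) i ^ 2 ∂P
    have hm : 0 ≤ m := integral_nonneg fun ω => sq_nonneg _
    have h3 : (1 + q / 2) * (m * (1 - q)) ≤ m * (1 - q / 2) := by
      nlinarith [mul_nonneg hm (sq_nonneg q)]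
    have hq1 : q ≤ 1 := by
      have : ∫ z, successIndicator z ∂(α.prod β) ≤ ∫ _, (1 : ℝ) ∂(α.prod β) :=
        integral_mono hg (integrable_const 1) successIndicator_le_one
      simpa using this
    have h4 : m * (1 - q / 2) ≤ C * (1 - q / 2) :=
      mul_le_mul_of_nonneg_right ih (by linarith)
    linarith

end

/-- The age at generation grows sublinearly along the squares. -/
lemma ae_tendsto_ageAtGeneration_div_sq {Ω : Type*} {X : ℕ → Ω → ℝ × ℝ × Bool}
    {mΩ : MeasurableSpace Ω} {P : Measure Ω} {a₀ C : ℝ}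
    (hW : ∀ i, MemLp (fun ω => ageAtGeneration a₀ (fun k => X k ω) i) 2 P)
    (hC : ∀ i, ∫ ω, ageAtGeneration a₀ (fun k => X k ω) i ^ 2 ∂P ≤ C) :
    ∀ᵐ ω ∂P, Tendsto (fun k : ℕ => ageAtGeneration a₀ (fun k => X k ω) (k ^ 2) / (k : ℝ) ^ 2)
      atTop (𝓝 0) := by
  refine ae_tendsto_zero_of_summable_integral_sq (a := fun k => C * (1 / (k : ℝ) ^ 4)) ?_ ?_
    ((Real.summable_one_div_nat_pow.2 (by norm_num)).mul_left C)
  · intro k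
    simp_rw [div_eq_inv_mul]
    exact (hW _).const_mul _
  · intro k
    simp_rw [div_pow, integral_div, ← pow_mul]
    rw [mul_one_div]
    exact div_le_div_of_nonneg_right (hC _) (by positivity)

/-! ### Sample paths: the area under the age between arrivals -/

namespace LCFSP

lemma genTime_succ (T : ℕ → ℝ) (i : ℕ) : genTime T (i + 1) = genTime T i + T i :=
  Finset.sum_range_succ _ _

lemma arrivalTime_eq_genTime (T : ℕ → ℝ) (i : ℕ) : arrivalTime T i = genTime T (i + 1) :=
  (genTime_succ T i).symm

lemma completionTime_eq (T O : ℕ → ℝ) (i : ℕ) :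
    completionTime T O i = genTime T (i + 1) + O i := by
  rw [completionTime, arrivalTime_eq_genTime]

lemma notPreempted_iff (T O : ℕ → ℝ) (i : ℕ) : NotPreempted T O i ↔ O i < T (i + 1) := by
  rw [NotPreempted, completionTime_eq, arrivalTime_eq_genTime, genTime_succ _ (i + 1)]
  constructor <;> intro h <;> linarith

section

variable {x : ℕ → ℝ × ℝ × Bool} {a₀ : ℝ}

lemma genTime_nonneg {T : ℕ → ℝ} (hT : ∀ i, 0 ≤ T i) (i : ℕ) : 0 ≤ genTime T i :=
  Finset.sum_nonneg fun k _ => hT k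

lemma monotone_genTime {T : ℕ → ℝ} (hT : ∀ i, 0 ≤ T i) : Monotone (genTime T) :=
  monotone_nat_of_le_succ fun i => by rw [genTime_succ]; linarith [hT i]

lemma genTime_le_of_accuratelyReceived {T O : ℕ → ℝ} {B : ℕ → Bool} (hT : ∀ i, 0 ≤ T i)
    (hO : ∀ i, 0 ≤ O i) {t : ℝ} {i : ℕ} (h : AccuratelyReceived T O B t i) : genTime T i ≤ t := by
  have := h.2.2
  rw [completionTime_eq, genTime_succ] at this
  linarith [hT i, hO i]

lemma bddAbove_receivedGenTimes {T O : ℕ → ℝ} (hT : ∀ i, 0 ≤ T i) (hO : ∀ i, 0 ≤ O i)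
    (a₀ : ℝ) (B : ℕ → Bool) (t : ℝ) :
    BddAbove (insert (-a₀) (genTime T '' {i | AccuratelyReceived T O B t i})) := by
  refine BddAbove.insert _ ⟨t, ?_⟩
  rintro _ ⟨i, hi, rfl⟩
  exact genTime_le_of_accuratelyReceived hT hO hi

lemma monotone_latestGenTime {T O : ℕ → ℝ} (hT : ∀ i, 0 ≤ T i) (hO : ∀ i, 0 ≤ O i)
    (a₀ : ℝ) (B : ℕ → Bool) : Monotone (latestGenTime a₀ T O B) := by
  intro s t hst
  refine csSup_le_csSup (bddAbove_receivedGenTimes hT hO a₀ B t) (Set.insert_nonempty _ _)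
    (Set.insert_subset_insert (Set.image_mono ?_))
  exact fun i hi => ⟨hi.1, hi.2.1, hi.2.2.trans hst⟩

lemma intervalIntegrable_AoPI {T O : ℕ → ℝ} (hT : ∀ i, 0 ≤ T i) (hO : ∀ i, 0 ≤ O i)
    (a₀ : ℝ) (B : ℕ → Bool) (a b : ℝ) :
    IntervalIntegrable (AoPI a₀ T O B) volume a b :=
  intervalIntegral.intervalIntegrable_id.sub (monotone_latestGenTime hT hO a₀ B).intervalIntegrable

lemma AoPI_nonneg {T O : ℕ → ℝ} (hT : ∀ i, 0 ≤ T i) (hO : ∀ i, 0 ≤ O i) (ha₀ : 0 ≤ a₀)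
    (B : ℕ → Bool) {t : ℝ} (ht : 0 ≤ t) : 0 ≤ AoPI a₀ T O B t := by
  refine sub_nonneg.2 (csSup_le (Set.insert_nonempty _ _) ?_)
  rintro _ (rfl | ⟨i, hi, rfl⟩)
  · linarith
  · exact genTime_le_of_accuratelyReceived hT hO hi

lemma integral_AoPI_of_latestGenTime_eq {T O : ℕ → ℝ} {B : ℕ → Bool} {a b c : ℝ} (hab : a ≤ b)
    (h : ∀ t, a ≤ t → t < b → latestGenTime a₀ T O B t = c) :
    ∫ t in a..b, AoPI a₀ T O B t = ((b - c) ^ 2 - (a - c) ^ 2) / 2 := by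
  have e : ∫ t in a..b, AoPI a₀ T O B t = ∫ t in a..b, (t - c) := by
    refine intervalIntegral.integral_congr_ae ?_
    -- The age may jump at `b`, where the hypothesis is silent; a single point is negligible.
    filter_upwards [Measure.ae_ne volume b] with t ht hmem
    rw [Set.uIoc_of_le hab] at hmem
    rw [AoPI, h t hmem.1.le (lt_of_le_of_ne hmem.2 ht)]
  rw [e, intervalIntegral.integral_comp_sub_right (fun t => t) c, integral_id]

/-- Frame `i` yields an accurate result. -/
def Succeeds (x : ℕ → ℝ × ℝ × Bool) (i : ℕ) : Prop := (x i).2.1 < (x (i + 1)).1 ∧ (x i).2.2 = true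

lemma successIndicator_of_succeeds {i : ℕ} (h : Succeeds x i) :
    successIndicator (serviceBlock x i) = 1 := if_pos h

lemma successIndicator_of_not_succeeds {i : ℕ} (h : ¬ Succeeds x i) :
    successIndicator (serviceBlock x i) = 0 := if_neg h

/-- Generation times increase with the index, so a success of frame `i` supersedes every earlier
one, and a failure leaves the maximum unchanged: this is the age recursion. -/
lemma isGreatest_genTime_sub_ageAtGeneration (ha₀ : 0 ≤ a₀) (hT : ∀ i, 0 ≤ (x i).1) (i : ℕ) :
    IsGreatest (insert (-a₀) (genTime (fun k => (x k).1) '' {j | j < i ∧ Succeeds x j}))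
      (genTime (fun k => (x k).1) i - ageAtGeneration a₀ x i) := by
  induction i with
  | zero => simp [genTime, ageAtGeneration, IsGreatest]
  | succ i ih =>
    rw [genTime_succ, ageAtGeneration]
    by_cases h : Succeeds x i
    · rw [successIndicator_of_succeeds h]
      have e : genTime (fun k => (x k).1) i + (x i).1 - ((x i).1 + (1 - 1) * ageAtGeneration a₀ x i)
          = genTime (fun k => (x k).1) i := by ring
      rw [e]
      refine ⟨Or.inr ⟨i, ⟨i.lt_succ_self, h⟩, rfl⟩, ?_⟩
      rintro _ (rfl | ⟨j, hj, rfl⟩)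
      · linarith [genTime_nonneg hT i]
      · exact monotone_genTime hT (Nat.lt_succ_iff.1 hj.1)
    · rw [successIndicator_of_not_succeeds h]
      have e : genTime (fun k => (x k).1) i + (x i).1 - ((x i).1 + (1 - 0) * ageAtGeneration a₀ x i)
          = genTime (fun k => (x k).1) i - ageAtGeneration a₀ x i := by ring
      have e2 : {j | j < i + 1 ∧ Succeeds x j} = {j | j < i ∧ Succeeds x j} := by
        ext j
        refine ⟨fun hj => ⟨?_, hj.2⟩, fun hj => ⟨hj.1.trans i.lt_succ_self, hj.2⟩⟩
        rcases Nat.lt_succ_iff_lt_or_eq.1 hj.1 with h' | rfl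
        · exact h'
        · exact absurd hj.2 h
      rw [e, e2]; exact ih

lemma latestGenTime_eq_of_received_iff (ha₀ : 0 ≤ a₀) (hT : ∀ i, 0 ≤ (x i).1) {t : ℝ} {i : ℕ}
    (h : ∀ j, AccuratelyReceived (fun k => (x k).1) (fun k => (x k).2.1) (fun k => (x k).2.2) t j
      ↔ j < i ∧ Succeeds x j) :
    latestGenTime a₀ (fun k => (x k).1) (fun k => (x k).2.1) (fun k => (x k).2.2) t
      = genTime (fun k => (x k).1) i - ageAtGeneration a₀ x i := by
  rw [latestGenTime]
  simp only [h]
  exact (isGreatest_genTime_sub_ageAtGeneration ha₀ hT i).csSup_eq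

lemma accuratelyReceived_iff {t : ℝ} {j : ℕ} :
    AccuratelyReceived (fun k => (x k).1) (fun k => (x k).2.1) (fun k => (x k).2.2) t j
      ↔ Succeeds x j ∧ genTime (fun k => (x k).1) (j + 1) + (x j).2.1 ≤ t := by
  rw [AccuratelyReceived, notPreempted_iff, completionTime_eq, Succeeds, and_assoc]

/-- A successful frame completes before the next arrival, hence before every later one. At the
arrival of frame `i`, all successes among earlier frames have thus been delivered. -/
lemma completion_lt_of_succeeds_of_lt (hT : ∀ i, 0 ≤ (x i).1) {i j : ℕ} (h : Succeeds x j)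
    (hij : j < i) :
    genTime (fun k => (x k).1) (j + 1) + (x j).2.1 < genTime (fun k => (x k).1) (i + 1) := by
  have h1 : genTime (fun k => (x k).1) (j + 2) ≤ genTime (fun k => (x k).1) (i + 1) :=
    monotone_genTime hT (by omega)
  rw [genTime_succ _ (j + 1)] at h1
  linarith [h.1]

lemma latestGenTime_before_completion (ha₀ : 0 ≤ a₀) (hT : ∀ i, 0 ≤ (x i).1)
    (hO : ∀ i, 0 ≤ (x i).2.1) {t : ℝ} {i : ℕ} (h1 : genTime (fun k => (x k).1) (i + 1) ≤ t)
    (h2 : t < genTime (fun k => (x k).1) (i + 2))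
    (h3 : Succeeds x i → t < genTime (fun k => (x k).1) (i + 1) + (x i).2.1) :
    latestGenTime a₀ (fun k => (x k).1) (fun k => (x k).2.1) (fun k => (x k).2.2) t
      = genTime (fun k => (x k).1) i - ageAtGeneration a₀ x i := by
  refine latestGenTime_eq_of_received_iff ha₀ hT fun j => ?_
  rw [accuratelyReceived_iff]
  constructor
  · rintro ⟨hs, hc⟩
    refine ⟨?_, hs⟩
    by_contra! hij
    rcases hij.eq_or_lt with rfl | hij
    · linarith [h3 hs]
    · have := monotone_genTime hT (show i + 2 ≤ j + 1 by omega)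
      linarith [hO j]
  · rintro ⟨hij, hs⟩
    exact ⟨hs, (completion_lt_of_succeeds_of_lt hT hs hij).le.trans h1⟩

lemma latestGenTime_after_completion (ha₀ : 0 ≤ a₀) (hT : ∀ i, 0 ≤ (x i).1)
    (hO : ∀ i, 0 ≤ (x i).2.1) {t : ℝ} {i : ℕ} (hs : Succeeds x i)
    (h1 : genTime (fun k => (x k).1) (i + 1) + (x i).2.1 ≤ t)
    (h2 : t < genTime (fun k => (x k).1) (i + 2)) :
    latestGenTime a₀ (fun k => (x k).1) (fun k => (x k).2.1) (fun k => (x k).2.2) t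
      = genTime (fun k => (x k).1) i := by
  rw [latestGenTime_eq_of_received_iff (i := i + 1) ha₀ hT, genTime_succ, ageAtGeneration,
    successIndicator_of_succeeds hs]
  · ring
  intro j
  rw [accuratelyReceived_iff]
  constructor
  · rintro ⟨hj, hc⟩
    refine ⟨?_, hj⟩
    by_contra! hij
    have := monotone_genTime hT (show i + 2 ≤ j + 1 by omega)
    linarith [hO j]
  · rintro ⟨hij, hj⟩
    refine ⟨hj, ?_⟩
    rcases Nat.lt_succ_iff_lt_or_eq.1 hij with h' | rfl
    · linarith [completion_lt_of_succeeds_of_lt hT hj h', hO i]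
    · exact h1

/-- The area under the age of processed information between two consecutive arrivals. -/
lemma integral_AoPI_between_arrivals (ha₀ : 0 ≤ a₀) (hT : ∀ i, 0 ≤ (x i).1)
    (hO : ∀ i, 0 ≤ (x i).2.1) (i : ℕ) :
    ∫ t in (genTime (fun k => (x k).1) (i + 1))..(genTime (fun k => (x k).1) (i + 2)),
        AoPI a₀ (fun k => (x k).1) (fun k => (x k).2.1) (fun k => (x k).2.2) t
      = (x i).1 * (x (i + 1)).1 + (x (i + 1)).1 ^ 2 / 2
        + ageAtGeneration a₀ x i * successDelay (serviceBlock x i) := by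
  have e1 := genTime_succ (fun k => (x k).1) i
  have e2 := genTime_succ (fun k => (x k).1) (i + 1)
  by_cases h : Succeeds x i
  · have hd : successDelay (serviceBlock x i) = (x i).2.1 := if_pos h
    have hlt := h.1
    -- On success the age drops at the completion of frame `i`, which splits the interval into two
    -- trapezoids.
    rw [← intervalIntegral.integral_add_adjacent_intervals
        (b := genTime (fun k => (x k).1) (i + 1) + (x i).2.1)
        (intervalIntegrable_AoPI hT hO a₀ _ _ _) (intervalIntegrable_AoPI hT hO a₀ _ _ _),
      integral_AoPI_of_latestGenTime_eq (by linarith [hO i]) fun t ht1 ht2 =>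
        latestGenTime_before_completion ha₀ hT hO ht1 (by linarith) fun _ => ht2,
      integral_AoPI_of_latestGenTime_eq (by linarith) fun t ht1 ht2 =>
        latestGenTime_after_completion ha₀ hT hO h ht1 ht2, hd, e2, e1]
    ring
  · have hd : successDelay (serviceBlock x i) = (x (i + 1)).1 := if_neg h
    rw [integral_AoPI_of_latestGenTime_eq (by linarith [hT (i + 1)]) fun t ht1 ht2 =>
        latestGenTime_before_completion ha₀ hT hO ht1 ht2 fun h' => absurd h' h, hd, e2, e1]
    ring

lemma integral_AoPI_genTime (ha₀ : 0 ≤ a₀) (hT : ∀ i, 0 ≤ (x i).1)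
    (hO : ∀ i, 0 ≤ (x i).2.1) (n : ℕ) :
    ∫ t in (0 : ℝ)..(genTime (fun k => (x k).1) (n + 1)),
        AoPI a₀ (fun k => (x k).1) (fun k => (x k).2.1) (fun k => (x k).2.2) t
      = (∫ t in (0 : ℝ)..(genTime (fun k => (x k).1) 1),
          AoPI a₀ (fun k => (x k).1) (fun k => (x k).2.1) (fun k => (x k).2.2) t)
        + ∑ i ∈ Finset.range n, ((x i).1 * (x (i + 1)).1 + (x (i + 1)).1 ^ 2 / 2
          + ageAtGeneration a₀ x i * successDelay (serviceBlock x i)) := by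
  induction n with
  | zero => simp
  | succ n ih =>
    rw [Finset.sum_range_succ, ← add_assoc, ← ih, ← integral_AoPI_between_arrivals ha₀ hT hO,
      intervalIntegral.integral_add_adjacent_intervals
        (intervalIntegrable_AoPI hT hO a₀ _ _ _) (intervalIntegrable_AoPI hT hO a₀ _ _ _)]

end

end LCFSP

/-! ### Telescoping, and interpolation from squares to all times -/

/-- A monotone function whose ratio to the identity is controlled along a sequence `τ` of times,
both at `τ k` relative to `τ (k + 1)` and conversely, has a limiting ratio. -/
lemma tendsto_div_of_monotoneOn_of_tendsto_subseq {F : ℝ → ℝ} (hF : MonotoneOn F (Set.Ici 0))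
    (hF0 : ∀ t, 0 ≤ t → 0 ≤ F t) {τ : ℕ → ℝ} (hτ : ∀ k, 0 < τ k) (hτtop : Tendsto τ atTop atTop)
    {A : ℝ} (h1 : Tendsto (fun k => F (τ k) / τ (k + 1)) atTop (𝓝 A))
    (h2 : Tendsto (fun k => F (τ (k + 1)) / τ k) atTop (𝓝 A)) :
    Tendsto (fun t => F t / t) atTop (𝓝 A) := by
  rw [Metric.tendsto_atTop] at h1 h2 ⊢
  intro ε hε
  obtain ⟨K1, hK1⟩ := h1 ε hε
  obtain ⟨K2, hK2⟩ := h2 ε hε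
  obtain ⟨M, hM⟩ : ∃ M, ∀ k ≤ max K1 K2, τ k ≤ M := by
    obtain ⟨M, hM⟩ := ((Set.finite_Iic (max K1 K2)).image τ).bddAbove
    exact ⟨M, fun k hk => hM ⟨k, hk, rfl⟩⟩
  -- The sequence `τ` need not be monotone: `n` is the first index with `t < τ n`, so its
  -- predecessor satisfies `τ k ≤ t`, and `t ≥ M` forces `n` beyond both thresholds.
  refine ⟨M, fun t ht => ?_⟩
  have hex : ∃ k, t < τ k := ((tendsto_atTop.1 hτtop (t + 1)).exists).imp fun k hk => by linarith
  classical
  have hspec := Nat.find_spec hex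
  have hmin := fun k => Nat.find_min (m := k) hex
  set n := Nat.find hex
  have hn : max K1 K2 < n := by
    by_contra! hle
    linarith [hM n hle]
  obtain ⟨k, hk⟩ : ∃ k, n = k + 1 := ⟨n - 1, by omega⟩
  have hkt : τ k ≤ t := not_lt.1 (hmin k (by omega))
  rw [hk] at hspec
  have ht0 : 0 < t := (hτ k).trans_le hkt
  have b1 := hK1 k (by have := le_max_left K1 K2; omega)
  have b2 := hK2 k (by have := le_max_right K1 K2; omega)
  rw [Real.dist_eq, abs_lt] at b1 b2 ⊢
  have c1 : F (τ k) / τ (k + 1) ≤ F t / t :=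
    div_le_div₀ (hF0 t ht0.le) (hF (hτ k).le ht0.le hkt) ht0 hspec.le
  have c2 : F t / t ≤ F (τ (k + 1)) / τ k :=
    div_le_div₀ (hF0 _ (hτ _).le) (hF ht0.le (hτ _).le hspec.le) (hτ k) hkt
  constructor <;> linarith

/-- The recursion reads `W i * g i = T i - (W (i+1) - W i)`, which telescopes. -/
lemma sum_successIndicator_mul_ageAtGeneration (a₀ : ℝ) (x : ℕ → ℝ × ℝ × Bool) (n : ℕ) :
    ∑ i ∈ Finset.range n, ageAtGeneration a₀ x i * successIndicator (serviceBlock x i)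
      = ∑ i ∈ Finset.range n, (x i).1 - ageAtGeneration a₀ x n + a₀ := by
  induction n with
  | zero => simp [ageAtGeneration]
  | succ n ih =>
    rw [Finset.sum_range_succ, ih, Finset.sum_range_succ, ageAtGeneration]
    ring

/-- Splits the total area into martingale sums, sums governed by the classical strong law, and
boundary terms. The uncentered part `c * ∑ W i` is eliminated by telescoping, at the price of the
factor `c / q`. -/
lemma sum_area_eq {q m c : ℝ} (hq : q ≠ 0) (a₀ : ℝ) (x : ℕ → ℝ × ℝ × Bool) (n : ℕ) :
    ∑ i ∈ Finset.range n, ((x i).1 * (x (i + 1)).1 + (x (i + 1)).1 ^ 2 / 2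
        + ageAtGeneration a₀ x i * successDelay (serviceBlock x i))
      = ∑ i ∈ Finset.range n, (x i).1 * ((x (i + 1)).1 - m)
        + (m + c / q) * ∑ i ∈ Finset.range n, (x i).1
        + (∑ i ∈ Finset.range n, (x (i + 1)).1 ^ 2) / 2
        + ∑ i ∈ Finset.range n, ageAtGeneration a₀ x i * (successDelay (serviceBlock x i) - c)
        - c / q * (ageAtGeneration a₀ x n - a₀ + ∑ i ∈ Finset.range n,
            ageAtGeneration a₀ x i * (successIndicator (serviceBlock x i) - q)) := by
  have h := sum_successIndicator_mul_ageAtGeneration a₀ x n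
  simp only [mul_sub, Finset.sum_sub_distrib, Finset.sum_add_distrib, ← Finset.sum_mul,
    ← Finset.sum_div] at h ⊢
  rw [h]
  field_simp
  ring

lemma tendsto_const_div_natCast_sq (a : ℝ) :
    Tendsto (fun k : ℕ => a / (k : ℝ) ^ 2) atTop (𝓝 0) :=
  ((tendsto_pow_atTop two_ne_zero).comp tendsto_natCast_atTop_atTop).const_div_atTop a

lemma tendsto_sq_div_succ_sq_add_one :
    Tendsto (fun k : ℕ => (k : ℝ) ^ 2 / (((k + 1) ^ 2 + 1 : ℕ) : ℝ)) atTop (𝓝 1) := by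
  have h1 : Tendsto (fun k : ℕ => 1 / (k : ℝ)) atTop (𝓝 0) := tendsto_one_div_atTop_nhds_zero_nat
  have h2 : Tendsto (fun k : ℕ => 1 / ((1 + 1 / (k : ℝ)) ^ 2 + (1 / (k : ℝ)) ^ 2)) atTop
      (𝓝 (1 / ((1 + 0) ^ 2 + 0 ^ 2))) :=
    tendsto_const_nhds.div (((h1.const_add 1).pow 2).add (h1.pow 2)) (by norm_num)
  norm_num only at h2
  refine h2.congr' ?_
  filter_upwards [eventually_gt_atTop 0] with k hk
  have : (0 : ℝ) < k := Nat.cast_pos.2 hk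
  push_cast
  field_simp

lemma tendsto_succ_sq_div_sq_add_one :
    Tendsto (fun k : ℕ => ((k + 1 : ℕ) : ℝ) ^ 2 / ((k ^ 2 + 1 : ℕ) : ℝ)) atTop (𝓝 1) := by
  have h1 : Tendsto (fun k : ℕ => 1 / (k : ℝ)) atTop (𝓝 0) := tendsto_one_div_atTop_nhds_zero_nat
  have h2 : Tendsto (fun k : ℕ => (1 + 1 / (k : ℝ)) ^ 2 / (1 + (1 / (k : ℝ)) ^ 2)) atTop
      (𝓝 ((1 + 0) ^ 2 / (1 + 0 ^ 2))) :=
    ((h1.const_add 1).pow 2).div ((h1.pow 2).const_add 1) (by norm_num)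
  norm_num only at h2
  refine h2.congr' ?_
  filter_upwards [eventually_gt_atTop 0] with k hk
  have : (0 : ℝ) < k := Nat.cast_pos.2 hk
  push_cast
  field_simp

/-- A monotone function with known growth along times `τ k` of order `k ^ 2`. -/
lemma tendsto_div_of_tendsto_along_squares {F : ℝ → ℝ} (hF : MonotoneOn F (Set.Ici 0))
    (hF0 : ∀ t, 0 ≤ t → 0 ≤ F t) {τ : ℕ → ℝ} (hτ : ∀ k, 0 < τ k) {m J : ℝ} (hm : 0 < m)
    (hτm : Tendsto (fun k : ℕ => τ k / ((k ^ 2 + 1 : ℕ) : ℝ)) atTop (𝓝 m))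
    (hFτ : Tendsto (fun k : ℕ => F (τ k) / (k : ℝ) ^ 2) atTop (𝓝 J)) :
    Tendsto (fun t => F t / t) atTop (𝓝 (J / m)) := by
  have hk2 : Tendsto (fun k : ℕ => k ^ 2 + 1) atTop atTop :=
    tendsto_atTop_mono (fun k => Nat.le_succ _) (tendsto_pow_atTop two_ne_zero)
  have hτm' : Tendsto (fun k : ℕ => ((k ^ 2 + 1 : ℕ) : ℝ) / τ k) atTop (𝓝 m⁻¹) := by
    simpa using hτm.inv₀ hm.ne'
  have hτtop : Tendsto τ atTop atTop := by
    have := (tendsto_natCast_atTop_atTop (R := ℝ)).comp hk2 |>.atTop_mul_pos hm hτm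
    refine this.congr fun k => ?_
    simp only [Function.comp_apply]
    field_simp
  refine tendsto_div_of_monotoneOn_of_tendsto_subseq hF hF0 hτ hτtop ?_ ?_
  · have := (hFτ.mul tendsto_sq_div_succ_sq_add_one).mul (hτm'.comp (tendsto_add_atTop_nat 1))
    rw [mul_one, ← div_eq_mul_inv] at this
    refine this.congr' ?_
    filter_upwards [eventually_gt_atTop 0] with k hk
    have h1 : (k : ℝ) ≠ 0 := Nat.cast_ne_zero.2 hk.ne'
    have h2 : (((k + 1) ^ 2 + 1 : ℕ) : ℝ) ≠ 0 := Nat.cast_ne_zero.2 (Nat.succ_ne_zero _)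
    simp only [Function.comp_apply]
    field_simp
  · have := ((hFτ.comp (tendsto_add_atTop_nat 1)).mul tendsto_succ_sq_div_sq_add_one).mul hτm'
    rw [mul_one, ← div_eq_mul_inv] at this
    refine this.congr fun k => ?_
    have h1 : ((k + 1 : ℕ) : ℝ) ≠ 0 := Nat.cast_ne_zero.2 (Nat.succ_ne_zero _)
    have h2 : ((k ^ 2 + 1 : ℕ) : ℝ) ≠ 0 := Nat.cast_ne_zero.2 (Nat.succ_ne_zero _)
    simp only [Function.comp_apply]
    field_simp

/-! ### The almost sure limit -/

namespace LCFSP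

/-- Convergence of the average age of processed information along a fixed sample path, from the
laws of large numbers for the arrival times and for the areas. -/
lemma tendsto_averageAoPI {x : ℕ → ℝ × ℝ × Bool} {a₀ m J : ℝ} (ha₀ : 0 ≤ a₀)
    (hT : ∀ i, 0 < (x i).1) (hO : ∀ i, 0 < (x i).2.1) (hm : 0 < m)
    (hmean : Tendsto (fun n : ℕ => (∑ i ∈ Finset.range n, (x i).1) / n) atTop (𝓝 m))
    (harea : Tendsto (fun k : ℕ => (∑ i ∈ Finset.range (k ^ 2), ((x i).1 * (x (i + 1)).1
      + (x (i + 1)).1 ^ 2 / 2 + ageAtGeneration a₀ x i * successDelay (serviceBlock x i)))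
        / (k : ℝ) ^ 2) atTop (𝓝 J)) :
    Tendsto (averageAoPI a₀ (fun k => (x k).1) (fun k => (x k).2.1) (fun k => (x k).2.2)) atTop
      (𝓝 (J / m)) := by
  have hT' := fun i => (hT i).le
  have hO' := fun i => (hO i).le
  set F : ℝ → ℝ := fun t => ∫ s in (0 : ℝ)..t,
    AoPI a₀ (fun k => (x k).1) (fun k => (x k).2.1) (fun k => (x k).2.2) s with hF
  -- The shift by one is forced: the areas of frames `0, …, n - 1` fill the time from the first
  -- arrival, `genTime 1`, to `genTime (n + 1)`. The area before the first arrival is a constant and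
  -- washes out.
  set τ : ℕ → ℝ := fun k => genTime (fun k => (x k).1) (k ^ 2 + 1) with hτ
  have hInt := intervalIntegrable_AoPI hT' hO' a₀ (fun k => (x k).2.2)
  have hτpos : ∀ k, 0 < τ k := fun k =>
    Finset.sum_pos (fun i _ => hT i) (Finset.nonempty_range_iff.2 (Nat.succ_ne_zero _))
  have hFmono : MonotoneOn F (Set.Ici 0) := by
    intro s hs t ht hst
    have : F t = F s + ∫ u in s..t,
        AoPI a₀ (fun k => (x k).1) (fun k => (x k).2.1) (fun k => (x k).2.2) u :=
      (intervalIntegral.integral_add_adjacent_intervals (hInt _ _) (hInt _ _)).symm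
    rw [this]
    have := intervalIntegral.integral_nonneg (μ := volume) hst fun u hu =>
      AoPI_nonneg hT' hO' ha₀ (fun k => (x k).2.2) (le_trans hs hu.1)
    linarith
  have hF0 : ∀ t, 0 ≤ t → 0 ≤ F t := fun t ht =>
    intervalIntegral.integral_nonneg ht fun u hu => AoPI_nonneg hT' hO' ha₀ _ hu.1
  have hFτ : Tendsto (fun k : ℕ => F (τ k) / (k : ℝ) ^ 2) atTop (𝓝 J) := by
    have := (tendsto_const_div_natCast_sq (F (genTime (fun k => (x k).1) 1))).add harea
    rw [zero_add] at this
    refine this.congr fun k => ?_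
    rw [← add_div, hF, hτ]
    exact congrArg (· / _) (integral_AoPI_genTime ha₀ hT' hO' (k ^ 2)).symm
  have hk2 : Tendsto (fun k : ℕ => k ^ 2 + 1) atTop atTop :=
    tendsto_atTop_mono (fun k => Nat.le_succ _) (tendsto_pow_atTop two_ne_zero)
  exact tendsto_div_of_tendsto_along_squares hFmono hF0 hτpos hm (hmean.comp hk2) hFτ

/-- The long-run average age of processed information for measurable random variables. -/
lemma ae_tendsto_averageAoPI {Ω : Type*} {mΩ : MeasurableSpace Ω} {P : Measure Ω}
    [IsProbabilityMeasure P] {lam mu : ℝ} (hlam : 0 < lam) (hmu : 0 < mu)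
    {p : unitInterval} (hp : 0 < p) {X : ℕ → Ω → ℝ × ℝ × Bool} (hX : ∀ i, Measurable (X i))
    (hindep : iIndepFun X P) (hlaw : ∀ i, HasLaw (X i) (expExpBernoulli lam mu p) P)
    {a₀ : ℝ} (ha₀ : 0 ≤ a₀) :
    ∀ᵐ ω ∂P, (∀ i, 0 < (X i ω).1) ∧ (∀ i, 0 < (X i ω).2.1) ∧
      Tendsto (averageAoPI a₀ (fun i => (X i ω).1) (fun i => (X i ω).2.1) (fun i => (X i ω).2.2))
        atTop (𝓝 ((1 + 1 / (p : ℝ)) * (1 / lam) + 1 / ((p : ℝ) * mu))) := by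
  have := isProbabilityMeasure_expMeasure hlam
  have := isProbabilityMeasure_expMeasure hmu
  have hp' : (0 : ℝ) < p := hp
  have hlawT : ∀ i, HasLaw (fun ω => (X i ω).1) (expMeasure lam) P := fun i =>
    (measurePreserving_fst_expExpBernoulli hmu hlam p).fun_comp_hasLaw (hlaw i)
  have hlawO : ∀ i, HasLaw (fun ω => (X i ω).2.1) (expMeasure mu) P := fun i =>
    (measurePreserving_snd_fst_expExpBernoulli hlam hmu p).fun_comp_hasLaw (hlaw i)
  have hTpos : ∀ᵐ ω ∂P, ∀ i, 0 < (X i ω).1 := ae_all_iff.2 fun i =>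
    ((hlawT i).ae_iff (p := fun t => 0 < t) (by fun_prop)).2 (ae_pos_expMeasure lam)
  have hOpos : ∀ᵐ ω ∂P, ∀ i, 0 < (X i ω).2.1 := ae_all_iff.2 fun i =>
    ((hlawO i).ae_iff (p := fun t => 0 < t) (by fun_prop)).2 (ae_pos_expMeasure mu)
  have hTL : ∀ i, MemLp (fun ω => (X i ω).1) 2 P := fun i =>
    ((hlawT i).map_eq ▸ memLp_id_expMeasure hlam :
      MemLp (fun t : ℝ => t) 2 (P.map _)).comp_of_map (hlawT i).aemeasurable
  have hTind : Pairwise fun i j => IndepFun (fun ω => (X i ω).1) (fun ω => (X j ω).1) P :=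
    fun i j hij => (hindep.indepFun hij).comp measurable_fst measurable_fst
  have hident : ∀ i j, IdentDistrib (fun ω => (X i ω).1) (fun ω => (X j ω).1) P P := fun i j =>
    ⟨(hlawT i).aemeasurable, (hlawT j).aemeasurable, (hlawT i).map_eq.trans (hlawT j).map_eq.symm⟩
  have hmean := strong_law_ae_real (fun i ω => (X i ω).1) ((hTL 0).integrable one_le_two)
    hTind fun i => hident i 0
  have hsq := strong_law_ae_real (fun i ω => (X (i + 1) ω).1 ^ 2) (hTL 1).integrable_sq
    (fun i j hij => (hTind (by omega : i + 1 ≠ j + 1)).comp (φ := fun t => t ^ 2)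
      (ψ := fun t => t ^ 2) (by fun_prop) (by fun_prop))
    fun i => (hident (i + 1) 1).comp (u := fun t => t ^ 2) (by fun_prop)
  have e1 : ∫ ω, (X 0 ω).1 ∂P = 1 / lam :=
    ((hlawT 0).integral_comp (f := fun t => t) (by fun_prop)).trans (integral_id_expMeasure hlam)
  have e2 : ∫ ω, (X (0 + 1) ω).1 ^ 2 ∂P = 2 / lam ^ 2 :=
    ((hlawT 1).integral_comp (f := fun t => t ^ 2) (by fun_prop)).trans
      (by rw [integral_pow_expMeasure hlam]; simp)
  set q : ℝ := p * (mu / (lam + mu)) with hq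
  have hq0 : 0 < q := by positivity
  have hqint := integral_successIndicator hlam hmu p
  obtain ⟨C, hC⟩ := exists_integral_sq_ageAtGeneration_le hX hindep hlaw
    (memLp_id_expMeasure hlam) (by rw [← expExpBernoulli, hqint]; exact hq0) a₀
  have hW := memLp_ageAtGeneration hX hTL a₀
  have hWm := measurable_pastInfo_ageAtGeneration (X := X) a₀
  have hgL : MemLp successIndicator 2 (expExpBernoulli lam mu p) := by
    have := isProbabilityMeasure_expExpBernoulli hlam hmu p
    refine MemLp.of_bound measurable_successIndicator.aestronglyMeasurable 1
      (Eventually.of_forall fun z => ?_)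
    rw [Real.norm_of_nonneg (successIndicator_nonneg z)]
    exact successIndicator_le_one z
  have l1 := ae_tendsto_sum_mul_centered hX hindep hlaw hWm hW hC measurable_successIndicator hgL
  have l2 := ae_tendsto_sum_mul_centered hX hindep hlaw hWm hW hC measurable_successDelay
    (memLp_successDelay hlam hmu p)
  have l3 := ae_tendsto_sum_mul_centered hX hindep hlaw (V := fun i ω => (X i ω).1)
    measurable_pastInfo_fst hTL (C := 2 / lam ^ 2) (fun i => le_of_eq
      (((hlawT i).integral_comp (f := fun t => t ^ 2) (by fun_prop)).trans
        (by rw [integral_pow_expMeasure hlam]; simp))) measurable_fst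
    ((memLp_id_expMeasure hlam).comp_measurePreserving
      (measurePreserving_fst_expExpBernoulli hmu hlam p))
  have e3 : ∫ z : ℝ × ℝ × Bool, z.1 ∂(expExpBernoulli lam mu p) = 1 / lam := by
    rw [← integral_id_expMeasure hlam, ← (measurePreserving_fst_expExpBernoulli hmu hlam p).map_eq,
      integral_map measurable_fst.aemeasurable (by fun_prop)]
  rw [← expExpBernoulli, hqint, ← hq] at l1
  rw [← expExpBernoulli, integral_successDelay hlam hmu p, ← hq] at l2
  rw [← expExpBernoulli, e3] at l3
  have l4 := ae_tendsto_ageAtGeneration_div_sq hW hC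
  filter_upwards [hTpos, hOpos, hmean, hsq, l1, l2, l3, l4] with ω hT hO hmean hsq l1 l2 l3 l4
  refine ⟨hT, hO, ?_⟩
  rw [e1] at hmean
  rw [e2] at hsq
  set x : ℕ → ℝ × ℝ × Bool := fun i => X i ω
  set c : ℝ := (1 - q) * (1 / lam)
  have hk2 : Tendsto (fun k : ℕ => k ^ 2) atTop atTop := tendsto_pow_atTop two_ne_zero
  have hmean2 := hmean.comp hk2
  have hsq2 := hsq.comp hk2
  -- Only the two classical averages survive, giving `(1 / lam + c / q) / lam + 1 / lam ^ 2`.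
  have hlim := (((l3.add (hmean2.const_mul (1 / lam + c / q))).add (hsq2.div_const 2)).add l2).sub
    (((l4.sub (tendsto_const_div_natCast_sq a₀)).add l1).const_mul (c / q))
  have hfinal := tendsto_averageAoPI (x := x) ha₀ hT hO (one_div_pos.2 hlam) hmean
    (hlim.congr fun k => by
      rw [sum_area_eq (m := 1 / lam) (c := c) hq0.ne' a₀ x (k ^ 2)]
      simp only [Function.comp_apply, Nat.cast_pow]
      simp only [serviceBlock, x]
      ring)
  convert hfinal using 2
  simp only [c, hq]
  field_simp
  ring

end LCFSP

/-- Long-run average age of processed information under last-come-first-serve with preemption.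
The triples (transmission time, computation time, accuracy of the recognition) of the frames are
independent, and within each frame the three components are independent with laws
`Exp(lam)`, `Exp(mu)` and `Bernoulli(p)`. -/
theorem theorem2 {Ω : Type*} [MeasurableSpace Ω] (P : Measure Ω) [IsProbabilityMeasure P]
    (lam mu : ℝ) (hlam : 0 < lam) (hmu : 0 < mu)
    (p : unitInterval) (hp : 0 < p)
    (T O : ℕ → Ω → ℝ) (B : ℕ → Ω → Bool)
    (hindep : iIndepFun (fun (i : ℕ) (ω : Ω) => (T i ω, O i ω, B i ω)) P)
    (hlaw : ∀ i : ℕ, HasLaw (fun ω : Ω => (T i ω, O i ω, B i ω))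
      ((expMeasure lam).prod ((expMeasure mu).prod (bernoulliMeasure true false p))) P)
    (a₀ : ℝ) (ha₀ : 0 ≤ a₀) :
    ∀ᵐ ω ∂P,
      (∀ t : ℝ, 0 ≤ t → IntervalIntegrable
        (LCFSP.AoPI a₀ (fun i => T i ω) (fun i => O i ω) (fun i => B i ω)) volume 0 t) ∧
      Tendsto
        (fun t : ℝ =>
          LCFSP.averageAoPI a₀ (fun i => T i ω) (fun i => O i ω) (fun i => B i ω) t)
        atTop
        (𝓝 ((1 + 1 / (p : ℝ)) * (1 / lam) + 1 / ((p : ℝ) * mu))) := by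
  -- `HasLaw` provides only almost everywhere measurability, so the triples are replaced by
  -- measurable versions, equal to them for all `i` at once almost surely.
  have hmk := fun i => (hlaw i).aemeasurable.ae_eq_mk
  have h := LCFSP.ae_tendsto_averageAoPI hlam hmu hp
    (fun i => (hlaw i).aemeasurable.measurable_mk) (hindep.congr hmk)
    (fun i => (hlaw i).congr (hmk i).symm) ha₀
  filter_upwards [h, ae_all_iff.2 hmk] with ω hω hmkω
  simp only [← hmkω] at hω
  exact ⟨fun t _ => LCFSP.intervalIntegrable_AoPI (fun i => (hω.1 i).le)
    (fun i => (hω.2.1 i).le) a₀ _ 0 t, hω.2.2⟩
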